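/- Let $K$ be a field. For distinct positive integers $a_1<\dots<a_n$ with $\gcd(a_1,\dots,a_n)=1$, let $I(\mathbf a)\subset K[x_1,\dots,x_n]$ be the kernel of the $K$-algebra homomorphism $K[x_1,\dots,x_n]\to K[t]$, $x_i\mapsto t^{a_i}$, and let $I(\mathbf a)^h\subset K[x_0,x_1,\dots,x_n]$ be its homogenization with respect to $x_0$, i.e. the ideal generated by the homogenizations of all elements of $I(\mathbf a)$. The projective monomial curve $\overline{C(\mathbf a)}\subset\mathbb P^n$ associated to $\mathbf a$ is the projective closure, with ideal $I(\mathbf a)^h$, of the affine curve $t\mapsto(t^{a_1},\dots,t^{a_n})$. It is called arithmetically Cohen–Macaulay if $I(\mathbf a)^h$ is a Cohen–Macaulay ideal, i.e. if $K[x_0,\dots,x_n]/I(\mathbf a)^h$ is a Cohen–Macaulay ring. Proposition. For every integer $h\ge 2$ and every field $K$, the projective monomial curve in $\mathbb P^3$ associated to the generators $$(2h-1)2h,\quad (2h-1)(2h+1),\quad 2h(2h+1),\quad 2h(2h+1)+2h-1$$ of Bresinsky's semigroup $B_h$ is not arithmetically Cohen–Macaulay. -/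

import Mathlib

/-- A Noetherian local ring is Cohen-Macaulay if its depth equals its Krull dimension, that is, if
its maximal ideal contains a regular sequence whose length is the Krull dimension. -/
def IsCohenMacaulayLocalRing (R : Type*) [CommRing R] [IsLocalRing R] : Prop :=
  IsNoetherianRing R ∧
    ∃ rs : List R, (∀ r ∈ rs, r ∈ IsLocalRing.maximalIdeal R) ∧
      RingTheory.Sequence.IsRegular R rs ∧ (rs.length : WithBot ℕ∞) = ringKrullDim R

/-- A Noetherian ring is Cohen-Macaulay if all its localizations at maximal ideals are. -/
def IsCohenMacaulayRing (R : Type*) [CommRing R] : Prop :=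
  IsNoetherianRing R ∧
    ∀ (m : Ideal R) [m.IsMaximal], IsCohenMacaulayLocalRing (Localization.AtPrime m)

/-- An ideal `I` of `R` is a Cohen-Macaulay ideal if the quotient ring `R / I` is
Cohen-Macaulay. -/
def IsCohenMacaulayIdeal {R : Type*} [CommRing R] (I : Ideal R) : Prop :=
  IsCohenMacaulayRing (R ⧸ I)

/-- The homogenization `f ^ h` of a polynomial `f` in the variables `x_1, ..., x_n` with respect
to a new variable `x_0`: each monomial `x ^ m` of `f` is multiplied by `x_0 ^ (deg f - |m|)`.
The variable `x_0` has index `0` in `Fin (n + 1)`, and the old variables are moved by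
`Fin.succ`. -/
noncomputable def homogenizePolynomial {K : Type*} [Field K] {n : ℕ}
    (f : MvPolynomial (Fin n) K) : MvPolynomial (Fin (n + 1)) K :=
  ∑ m ∈ f.support,
    MvPolynomial.monomial (Finsupp.cons (f.totalDegree - m.degree) m) (f.coeff m)

/-- The homogenization `I ^ h` of an ideal `I` with respect to the new variable `x_0`: the ideal
generated by the homogenizations of all the elements of `I`. -/
noncomputable def homogenizeIdeal {K : Type*} [Field K] {n : ℕ}
    (I : Ideal (MvPolynomial (Fin n) K)) : Ideal (MvPolynomial (Fin (n + 1)) K) :=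
  Ideal.span (homogenizePolynomial '' (I : Set (MvPolynomial (Fin n) K)))

/-- The ideal `I(a)` of the affine monomial curve `t ↦ (t ^ a_1, ..., t ^ a_n)`: the kernel of the
`K`-algebra homomorphism `K[x_1, ..., x_n] → K[t]`, `x_i ↦ t ^ a_i`. -/
noncomputable def monomialCurveIdeal (K : Type*) [Field K] {n : ℕ} (a : Fin n → ℕ) :
    Ideal (MvPolynomial (Fin n) K) :=
  RingHom.ker (MvPolynomial.aeval (R := K) fun i => (Polynomial.X : Polynomial K) ^ a i)

/-- The projective monomial curve over `K` of the sequence `a`, the projective closure of the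
affine monomial curve of `a`, is arithmetically Cohen-Macaulay if its ideal `I(a) ^ h` is
a Cohen-Macaulay ideal. -/
def IsArithmeticallyCohenMacaulay (K : Type*) [Field K] {n : ℕ} (a : Fin n → ℕ) : Prop :=
  IsCohenMacaulayIdeal (homogenizeIdeal (monomialCurveIdeal K a))

/-- The generators, listed increasingly, of Bresinsky's semigroup `B_h` (for `h ≥ 2`). -/
def bresinskyGenerators (h : ℕ) : Fin 4 → ℕ :=
  ![(2 * h - 1) * (2 * h), (2 * h - 1) * (2 * h + 1), 2 * h * (2 * h + 1),
    2 * h * (2 * h + 1) + (2 * h - 1)]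

/-! Put r = 2h - 1. The homogeneous coordinate ring is the monomial ring A = K[s, s t^(a_1), ..., s
t^(a_4)], a domain whose vertex has height at least two. For w = (r+1) a_1 + r a_4, the monomial
s^(2r) t^w is not in A, since w has no factorization of length at most 2r
(`bresinsky_no_short_factorization`), yet its product with every generator of A is in A. A
Cohen-Macaulay local domain of dimension at least two admits no such fraction
(`IsCohenMacaulayLocalRing.dvd_of_forall_dvd_mul`), so A fails to be Cohen-Macaulay at the vertex.
-/

/-! ### Kernels of monomial maps -/

open MvPolynomial in
theorem aeval_monomial_monomial {K σ τ : Type*} [Field K] (e : σ → (τ →₀ ℕ))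
    (m : σ →₀ ℕ) (c : K) :
    aeval (fun i => (monomial (e i) (1 : K))) (monomial m c) = monomial (Finsupp.weight e m) c := by
  rw [aeval_monomial, Finsupp.weight_apply, algebraMap_eq, Finsupp.prod, Finsupp.sum]
  simp only [monomial_pow, one_pow]
  rw [← monomial_sum_one, C_mul_monomial, mul_one]

open MvPolynomial in
/-- The kernel of a `K`-algebra homomorphism sending variables to monomials is generated by
binomials. -/
theorem ker_aeval_monomial_le {K σ τ : Type*} [Field K] (e : σ → (τ →₀ ℕ))
    (J : Ideal (MvPolynomial σ K))
    (hJ : ∀ u v : σ →₀ ℕ, Finsupp.weight e u = Finsupp.weight e v →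
      monomial u (1 : K) - monomial v 1 ∈ J) :
    RingHom.ker (aeval (R := K) fun i => (monomial (e i) (1 : K))) ≤ J := by
  intro F hF
  -- `s` picks one monomial in each fibre of the weight; `L` undoes the map up to binomials in `J`.
  let s : (τ →₀ ℕ) → (σ →₀ ℕ) := Function.invFun (Finsupp.weight e)
  let L : MvPolynomial τ K →ₗ[K] MvPolynomial σ K :=
    (basisMonomials τ K).constr K fun m => monomial (s m) 1
  have hL (m : τ →₀ ℕ) (c : K) : L (monomial m c) = monomial (s m) c := by
    have h1 : L (monomial m 1) = monomial (s m) 1 := by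
      have := (basisMonomials τ K).constr_basis K (fun m => monomial (s m) (1 : K)) m
      rwa [coe_basisMonomials] at this
    rw [← mul_one c, ← smul_eq_mul, ← smul_monomial, map_smul, h1, smul_monomial]
  have key (G : MvPolynomial σ K) :
      G - L (aeval (R := K) (fun i => (monomial (e i) (1 : K))) G) ∈ J := by
    induction G using MvPolynomial.induction_on' with
    | monomial m c =>
      rw [aeval_monomial_monomial, hL]
      have := J.mul_mem_left (C c) (hJ m (s (Finsupp.weight e m))
        (Function.invFun_eq ⟨m, rfl⟩).symm)
      simpa [mul_sub, C_mul_monomial] using this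
    | add p q hp hq =>
      rw [map_add, map_add, add_sub_add_comm]
      exact add_mem hp hq
  have := key F
  rwa [RingHom.mem_ker.mp hF, map_zero, sub_zero] at this

/-! ### The homogenized ideal as a toric ideal -/

/-- The parametrization `x_0 ↦ s`, `x_i ↦ s t ^ a_i` of the cone over the projective monomial
curve of `a`. -/
noncomputable def projectiveMonomialMap (K : Type*) [Field K] {n : ℕ} (a : Fin n → ℕ) :
    MvPolynomial (Fin (n + 1)) K →ₐ[K] MvPolynomial (Fin 2) K :=
  MvPolynomial.aeval fun i =>
    MvPolynomial.monomial
      (Finsupp.single 0 1 + Finsupp.single 1 ((Fin.cons 0 a : Fin (n + 1) → ℕ) i)) 1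

open MvPolynomial in
theorem projectiveMonomialMap_X (K : Type*) [Field K] {n : ℕ} (a : Fin n → ℕ) (i : Fin (n + 1)) :
    projectiveMonomialMap K a (X i) = X 0 * X 1 ^ (Fin.cons 0 a : Fin (n + 1) → ℕ) i := by
  rw [projectiveMonomialMap, aeval_X, X_pow_eq_monomial, X, monomial_mul, one_mul]

open MvPolynomial in
theorem projectiveMonomialMap_homogenize {K : Type*} [Field K] {n : ℕ} (a : Fin n → ℕ)
    (f : MvPolynomial (Fin n) K) :
    projectiveMonomialMap K a (homogenizePolynomial f) = X 0 ^ f.totalDegree *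
      Polynomial.aeval (X 1 : MvPolynomial (Fin 2) K)
        (aeval (R := K) (fun i => (Polynomial.X : Polynomial K) ^ a i) f) := by
  have hf : aeval (R := K) (fun i => (Polynomial.X : Polynomial K) ^ a i) f =
      ∑ m ∈ f.support, aeval (R := K) (fun i => (Polynomial.X : Polynomial K) ^ a i)
        (monomial m (f.coeff m)) := by
    rw [← map_sum, ← f.as_sum]
  rw [hf, homogenizePolynomial, map_sum, map_sum, Finset.mul_sum]
  refine Finset.sum_congr rfl fun m hm => ?_
  have hd : m.degree ≤ f.totalDegree := by
    exact le_totalDegree hm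
  rw [monomial_eq, map_mul, Finsupp.prod_fintype _ _ (by simp), map_prod, Fin.prod_univ_succ,
    aeval_monomial, Finsupp.prod_fintype _ _ (by simp)]
  simp only [map_pow, projectiveMonomialMap_X, Finsupp.cons_zero, Finsupp.cons_succ, Fin.cons_zero,
    Fin.cons_succ, map_mul, map_prod, Polynomial.aeval_X, mul_pow, Finset.prod_mul_distrib,
    Finset.prod_pow_eq_pow_sum, pow_zero, mul_one]
  have : f.totalDegree = (f.totalDegree - m.degree) + ∑ i, m i := by
    rw [← Finsupp.degree_eq_sum]; omega
  conv_rhs => rw [this, pow_add]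
  simp [algHom_C]
  ring

theorem weight_projectiveMonomialMap_exponents {n : ℕ} (a : Fin n → ℕ) (u : Fin (n + 1) →₀ ℕ) :
    Finsupp.weight (fun i => (Finsupp.single 0 1 +
      Finsupp.single 1 ((Fin.cons 0 a : Fin (n + 1) → ℕ) i) : Fin 2 →₀ ℕ)) u =
    Finsupp.single 0 (u 0 + u.tail.degree) + Finsupp.single 1 (∑ i, u.tail i * a i) := by
  rw [Finsupp.weight_apply, Finsupp.sum_fintype _ _ (by simp)]
  ext j
  fin_cases j <;> simp [Fin.sum_univ_succ, Finsupp.degree_eq_sum, Finsupp.tail_apply]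

open MvPolynomial in
theorem homogenizePolynomial_binomial {K : Type*} [Field K] {n : ℕ} {u v : Fin n →₀ ℕ}
    (huv : u ≠ v) (hd : v.degree ≤ u.degree) :
    homogenizePolynomial (monomial u (1 : K) - monomial v 1) =
      monomial (Finsupp.cons 0 u) 1 - monomial (Finsupp.cons (u.degree - v.degree) v) 1 := by
  classical
  have hs : (monomial u (1 : K) - monomial v 1).support = {u, v} := by
    ext m
    simp only [mem_support_iff, coeff_sub, coeff_monomial, Finset.mem_insert, Finset.mem_singleton]
    by_cases h1 : u = m
    · subst h1; simp [huv.symm]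
    · by_cases h2 : v = m
      · subst h2; simp [huv]
      · simp [h1, h2, Ne.symm h1, Ne.symm h2]
  have ht : (monomial u (1 : K) - monomial v 1).totalDegree = u.degree := by
    rw [totalDegree, hs]
    rw [Finset.sup_insert, Finset.sup_singleton]
    exact sup_eq_left.mpr hd
  rw [homogenizePolynomial, hs, Finset.sum_pair huv, ht]
  simp [coeff_monomial, huv, huv.symm, sub_eq_add_neg]

-- The kernel is generated by binomials, and each nonzero one is, up to sign, a power of `x_0` times
-- the homogenization of a binomial of `I(a)`.
open MvPolynomial in
theorem homogenizeIdeal_eq_ker (K : Type*) [Field K] {n : ℕ} (a : Fin n → ℕ) :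
    homogenizeIdeal (monomialCurveIdeal K a) = RingHom.ker (projectiveMonomialMap K a) := by
  apply le_antisymm
  · rw [homogenizeIdeal, Ideal.span_le]
    rintro _ ⟨f, hf, rfl⟩
    have hf' : aeval (R := K) (fun i => (Polynomial.X : Polynomial K) ^ a i) f = 0 := hf
    simp [RingHom.mem_ker, projectiveMonomialMap_homogenize, hf']
  · apply ker_aeval_monomial_le
    suffices key : ∀ u v : Fin (n + 1) →₀ ℕ, v.tail.degree ≤ u.tail.degree →
        u 0 + u.tail.degree = v 0 + v.tail.degree →
        ∑ i, u.tail i * a i = ∑ i, v.tail i * a i →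
        monomial u (1 : K) - monomial v 1 ∈ homogenizeIdeal (monomialCurveIdeal K a) by
      intro u v huv
      rw [weight_projectiveMonomialMap_exponents, weight_projectiveMonomialMap_exponents] at huv
      have h0 := DFunLike.congr_fun huv 0
      have h1 := DFunLike.congr_fun huv 1
      simp at h0 h1
      rcases le_total v.tail.degree u.tail.degree with h | h
      · exact key u v h (by simpa using h0) h1
      · rw [← neg_sub]
        exact neg_mem (key v u h (by simpa using h0.symm) h1.symm)
    intro u v hd h0 h1
    by_cases ht : u.tail = v.tail
    · have : u = v := by
        rw [← Finsupp.cons_tail u, ← Finsupp.cons_tail v, ht]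
        congr 1
        rw [ht] at h0; omega
      simp [this]
    have hb : homogenizePolynomial (monomial u.tail (1 : K) - monomial v.tail 1) ∈
        homogenizeIdeal (monomialCurveIdeal K a) := by
      refine Ideal.subset_span ⟨_, ?_, rfl⟩
      change aeval (R := K) _ _ = 0
      rw [map_sub, aeval_monomial, aeval_monomial, Finsupp.prod_fintype _ _ (by simp),
        Finsupp.prod_fintype _ _ (by simp)]
      simp only [← pow_mul, Finset.prod_pow_eq_pow_sum, mul_comm (a _), h1, sub_self]
    rw [homogenizePolynomial_binomial ht hd] at hb
    have := Ideal.mul_mem_left _ (monomial (Finsupp.single 0 (u 0)) 1) hb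
    rw [mul_sub, monomial_mul, monomial_mul, one_mul] at this
    convert this using 4
    · conv_lhs => rw [← Finsupp.cons_tail u]
      ext i; refine Fin.cases ?_ (fun j => ?_) i <;> simp [Finsupp.tail_apply]
    · conv_lhs => rw [← Finsupp.cons_tail v]
      ext i; refine Fin.cases ?_ (fun j => ?_) i <;> simp [Finsupp.tail_apply]
      omega

/-! ### Depth and fractions -/

/-- In a Cohen-Macaulay local domain of dimension at least two, a fraction `p / x` multiplied into
the ring by the maximal ideal lies in the ring. -/
theorem IsCohenMacaulayLocalRing.dvd_of_forall_dvd_mul {B : Type*} [CommRing B] [IsDomain B]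
    [IsLocalRing B] (hB : IsCohenMacaulayLocalRing B) (hdim : 2 ≤ ringKrullDim B) {x p : B}
    (hx : x ≠ 0) (h : ∀ b ∈ IsLocalRing.maximalIdeal B, x ∣ b * p) : x ∣ p := by
  obtain ⟨-, rs, hmem, hreg, hlen⟩ := hB
  rw [← hlen] at hdim
  have hlen2 : 2 ≤ rs.length := by exact_mod_cast hdim
  match rs, hlen2 with
  | f :: g :: rs, _ =>
    rw [RingTheory.Sequence.isRegular_cons_iff, RingTheory.Sequence.isRegular_cons_iff] at hreg
    obtain ⟨hf, hg, -⟩ := hreg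
    obtain ⟨f', hf'⟩ := h f (hmem f (by simp))
    obtain ⟨g', hg'⟩ := h g (hmem g (by simp))
    -- With p = x f'/f = x g'/g, regularity of g modulo f forces f' = f z, whence p = x z.
    have hfg : g * f' = f * g' := by
      apply mul_left_cancel₀ hx
      linear_combination (-g) * hf' + f * hg'
    have hmk : (Submodule.Quotient.mk f' : QuotSMulTop f B) = 0 := by
      apply hg
      change g • (Submodule.Quotient.mk f' : QuotSMulTop f B) = g • 0
      rw [smul_zero, ← Submodule.Quotient.mk_smul, Submodule.Quotient.mk_eq_zero, smul_eq_mul, hfg]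
      exact Submodule.smul_mem_pointwise_smul g' f _ trivial
    rw [Submodule.Quotient.mk_eq_zero, Submodule.mem_smul_pointwise_iff_exists] at hmk
    obtain ⟨z, -, hz⟩ := hmk
    refine ⟨z, hf ?_⟩
    change f * p = f * (x * z)
    rw [hf', ← hz, smul_eq_mul]
    ring

/-! ### Arithmetic of the weights -/

/-- The weight of `x_1 ^ (r + 1) * x_4 ^ r` has no factorization of length less than `2 * r + 1`. -/
theorem bresinsky_no_short_factorization {r m₁ m₂ m₃ m₄ : ℕ} (hr : Odd r)
    (hlen : m₁ + m₂ + m₃ + m₄ ≤ 2 * r) :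
    m₁ * (r * (r + 1)) + m₂ * (r * (r + 2)) + m₃ * ((r + 1) * (r + 2)) +
      m₄ * ((r + 1) * (r + 2) + r) ≠
    (r + 1) * (r * (r + 1)) + r * ((r + 1) * (r + 2) + r) := by
  intro h
  obtain ⟨k, hk⟩ := hr
  have hlen' : (m₁ + m₂ + m₃ + m₄ : ℤ) ≤ 2 * r := by omega
  -- Modulo r + 1 the generators are 0, -1, 0, -1, and w is -r.
  have hdiv : ((r : ℤ) + 1) ∣ m₂ + m₄ - r := by
    refine ⟨(r + 1) * (m₁ + m₂ + m₃ + m₄) - m₁ + m₃ + 2 * m₄ - 2 * (r + 1) ^ 2 + 2, ?_⟩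
    zify at h
    linear_combination (-1) * h
  obtain ⟨q, hq⟩ := hdiv
  have hq0 : q = 0 := by
    have h1 : q < 1 := by
      by_contra hc
      nlinarith
    have h2 : -1 < q := by
      by_contra hc
      nlinarith
    omega
  subst hq0
  have hm2 : (m₂ : ℤ) = r - m₄ := by linarith
  have hj : ((r : ℤ) + 1) * (2 * r - (m₁ + m₂ + m₃ + m₄)) = m₃ - m₁ + 2 * m₄ - 2 * r := by
    have : ((r : ℤ) + 1) ≠ 0 := by positivity
    apply mul_left_cancel₀ this
    zify at h
    linear_combination (-1) * h - hq
  -- The right side of `hj` is at most `m₃` because m₄ ≤ r, and m₃ ≤ r because m₂ + m₄ = r.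
  have hj0 : (2 * r - (m₁ + m₂ + m₃ + m₄) : ℤ) = 0 := by
    have : (2 * r - (m₁ + m₂ + m₃ + m₄) : ℤ) < 1 := by
      by_contra hc
      nlinarith
    omega
  -- Now m₁ + m₃ = r is odd while m₃ - m₁ = 2r - 2m₄ is even.
  rw [hj0] at hj
  omega

/-! ### The vertex of the cone -/

open MvPolynomial in
/-- The vertex of the cone over a projective monomial curve has height at least two. -/
theorem two_le_height_ker_constantCoeff {K : Type*} [Field K] {n : ℕ} (a : Fin n → ℕ)
    (ha : ∃ i, 0 < a i) (m : Ideal (MvPolynomial (Fin (n + 1)) K ⧸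
      RingHom.ker (projectiveMonomialMap K a))) [m.IsPrime]
    (hm : m = RingHom.ker ((constantCoeff (R := K) (σ := Fin 2)).comp
      (Ideal.kerLiftAlg (projectiveMonomialMap K a)).toRingHom)) :
    2 ≤ m.height := by
  have hinj := Ideal.kerLiftAlg_injective (projectiveMonomialMap K a)
  set Ψ := Ideal.kerLiftAlg (projectiveMonomialMap K a) with hΨ
  have hX (i : Fin (n + 1)) : Ψ (Ideal.Quotient.mk _ (X i)) =
      X 0 * X 1 ^ (Fin.cons 0 a : Fin (n + 1) → ℕ) i := by
    rw [← projectiveMonomialMap_X K]; exact Ideal.kerLiftAlg_mk _ _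
  have := hinj.isDomain Ψ.toRingHom
  let E : MvPolynomial (Fin 2) K →ₐ[K] MvPolynomial (Fin 2) K := aeval ![X 0, 0]
  have hE : (constantCoeff (R := K) (σ := Fin 2)).comp E.toRingHom = constantCoeff := by
    refine MvPolynomial.ringHom_ext (fun c => by simp [E]) fun i => ?_
    fin_cases i <;> simp [E]
  -- The chain is 0 < P < m, with P the kernel of t = 0: it contains x_i when a_i > 0, but not x_0.
  let P := RingHom.ker (E.toRingHom.comp Ψ.toRingHom)
  have : P.IsPrime := RingHom.ker_isPrime _
  obtain ⟨i, hi⟩ := ha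
  have h0P : (⊥ : Ideal _) < P := by
    refine bot_lt_iff_ne_bot.mpr fun h => ?_
    have hmem : Ideal.Quotient.mk _ (X i.succ) ∈ P := by
      change E (Ψ _) = 0
      rw [hX]
      simp [E, hi.ne']
    rw [h, Ideal.mem_bot] at hmem
    have := hX i.succ
    rw [hmem, map_zero] at this
    exact (mul_ne_zero (X_ne_zero 0) (pow_ne_zero _ (X_ne_zero 1))) this.symm
  have hPm : P < m := by
    refine lt_of_le_of_ne (fun y hy => ?_) fun h => ?_
    · rw [hm, RingHom.mem_ker, ← hE]
      have : E (Ψ y) = 0 := hy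
      change constantCoeff (E (Ψ y)) = 0
      rw [this, map_zero]
    · have hmem : Ideal.Quotient.mk _ (X 0) ∈ m := by
        rw [hm]
        change constantCoeff (Ψ _) = 0
        rw [hX]
        simp
      rw [← h] at hmem
      have : E (Ψ _) = 0 := hmem
      rw [hX] at this
      simp [E] at this
  have h1 := Ideal.height_add_one_le_of_lt_of_isPrime h0P
  have h2 := Ideal.height_add_one_le_of_lt_of_isPrime hPm
  calc (2 : ℕ∞) = 0 + 1 + 1 := by norm_num
    _ ≤ (⊥ : Ideal _).height + 1 + 1 := by gcongr; exact zero_le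
    _ ≤ P.height + 1 := by gcongr
    _ ≤ m.height := h2

open MvPolynomial in
/-- If the cone over a projective monomial curve is Cohen-Macaulay, then every monomial in `s, t`
whose products with the images of all the variables lie in the homogeneous coordinate ring already
has the exponent of some monomial of that ring. -/
theorem IsArithmeticallyCohenMacaulay.exists_weight_eq {K : Type*} [Field K] {n : ℕ}
    {a : Fin n → ℕ} (hCM : IsArithmeticallyCohenMacaulay K a) (ha : ∃ i, 0 < a i)
    (γ : Fin 2 →₀ ℕ) (p : MvPolynomial (Fin (n + 1)) K)
    (hp : projectiveMonomialMap K a p = X 0 * monomial γ 1)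
    (h : ∀ i, ∃ q, projectiveMonomialMap K a q =
      X 1 ^ (Fin.cons 0 a : Fin (n + 1) → ℕ) i * (X 0 * monomial γ 1)) :
    ∃ m : Fin (n + 1) →₀ ℕ, Finsupp.weight (fun i => (Finsupp.single 0 1 +
      Finsupp.single 1 ((Fin.cons 0 a : Fin (n + 1) → ℕ) i) : Fin 2 →₀ ℕ)) m = γ := by
  rw [IsArithmeticallyCohenMacaulay, homogenizeIdeal_eq_ker, IsCohenMacaulayIdeal] at hCM
  have hinj := Ideal.kerLiftAlg_injective (projectiveMonomialMap K a)
  have hmk := Ideal.kerLiftAlg_mk (projectiveMonomialMap K a)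
  have hht := two_le_height_ker_constantCoeff (K := K) a ha
  set A := MvPolynomial (Fin (n + 1)) K ⧸ RingHom.ker (projectiveMonomialMap K a) with hA
  set Ψ := Ideal.kerLiftAlg (projectiveMonomialMap K a) with hΨ
  let mk : MvPolynomial (Fin (n + 1)) K →+* A := Ideal.Quotient.mk _
  replace hmk (F) : Ψ (mk F) = projectiveMonomialMap K a F := hmk F
  have : IsDomain A := hinj.isDomain Ψ.toRingHom
  let ε : A →+* K := (constantCoeff (R := K) (σ := Fin 2)).comp Ψ.toRingHom
  have hε (F) : ε (mk F) = constantCoeff F := by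
    have : ε.comp mk = constantCoeff := by
      refine MvPolynomial.ringHom_ext (fun c => ?_) fun i => ?_
      · change constantCoeff (Ψ (mk _)) = _
        rw [hmk, ← algebraMap_eq, AlgHom.commutes]; simp
      · change constantCoeff (Ψ (mk _)) = _
        rw [hmk, projectiveMonomialMap_X]; simp
    rw [← this]; rfl
  let m : Ideal A := RingHom.ker ε
  have : m.IsMaximal := RingHom.ker_isMaximal_of_surjective ε fun c =>
    ⟨mk (C c), by rw [hε, constantCoeff_C]⟩
  have hdvd (b : A) (hb : b ∈ m) : mk (X 0) ∣ b * mk p := by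
    obtain ⟨F, rfl⟩ := Ideal.Quotient.mk_surjective b
    have key (F : MvPolynomial (Fin (n + 1)) K) :
        mk (X 0) ∣ (mk F - mk (C (constantCoeff F))) * mk p := by
      induction F using MvPolynomial.induction_on with
      | C c => simp
      | add f g hf hg =>
        have := dvd_add hf hg
        convert this using 1
        simp only [map_add]; ring
      | mul_X f i _ =>
        obtain ⟨q, hq⟩ := h i
        have : mk (X i) * mk p = mk (X 0) * mk q := by
          apply hinj
          rw [map_mul, map_mul, hmk, hmk, hmk, hmk, hp, hq, projectiveMonomialMap_X,
            projectiveMonomialMap_X, Fin.cons_zero]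
          ring
        refine ⟨mk f * mk q, ?_⟩
        simp only [map_mul, constantCoeff_X, mul_zero, map_zero, sub_zero]
        linear_combination mk f * this
    have hF : constantCoeff F = 0 := by rw [← hε]; exact hb
    have := key F
    rwa [hF, map_zero, map_zero, sub_zero] at this
  let B := Localization.AtPrime m
  have : IsDomain B := IsLocalization.isDomain_localization m.primeCompl_le_nonZeroDivisors
  have hX0 : mk (X 0) ≠ 0 := by
    intro h0
    have := hmk (X 0)
    rw [h0, map_zero, projectiveMonomialMap_X, Fin.cons_zero, pow_zero, mul_one] at this
    exact X_ne_zero _ this.symm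
  have hBinj : Function.Injective (algebraMap A B) :=
    IsLocalization.injective B m.primeCompl_le_nonZeroDivisors
  have hdim : 2 ≤ ringKrullDim B := by
    rw [IsLocalization.AtPrime.ringKrullDim_eq_height m B]
    exact WithBot.coe_le_coe.mpr (hht m rfl)
  have hB : algebraMap A B (mk (X 0)) ∣ algebraMap A B (mk p) := by
    refine (hCM.2 m).dvd_of_forall_dvd_mul hdim
      ((map_ne_zero_iff _ hBinj).mpr hX0) fun b hb => ?_
    rw [← IsLocalization.AtPrime.map_eq_maximalIdeal m, Ideal.map] at hb
    induction hb using Submodule.span_induction with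
    | mem b hb =>
      obtain ⟨c, hc, rfl⟩ := hb
      rw [← map_mul]
      exact map_dvd _ (hdvd c hc)
    | zero => simp
    | add b c _ _ hb hc => rw [add_mul]; exact dvd_add hb hc
    | smul c b _ hb => rw [smul_eq_mul, mul_assoc]; exact hb.mul_left c
  obtain ⟨z, hz⟩ := hB
  obtain ⟨⟨y, s⟩, hys⟩ := IsLocalization.surj m.primeCompl z
  have hsp : (s : A) * mk p = mk (X 0) * y := by
    apply hBinj
    rw [map_mul, map_mul, ← hys, hz]; ring
  have hs : constantCoeff (Ψ s) ≠ 0 := s.2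
  obtain ⟨Y, rfl⟩ := Ideal.Quotient.mk_surjective y
  have hΨ' := congrArg Ψ hsp
  change Ψ _ = Ψ (_ * mk Y) at hΨ'
  rw [map_mul, map_mul, hmk, hmk, hmk, hp, projectiveMonomialMap_X, Fin.cons_zero, pow_zero,
    mul_one, mul_left_comm] at hΨ'
  have hY := mul_left_cancel₀ (X_ne_zero 0) hΨ'
  -- By `hY`, this coefficient is the constant term of the denominator `s`, a unit at the vertex.
  have hc : coeff γ (projectiveMonomialMap K a Y) ≠ 0 := by
    rw [← hY, coeff_mul_monomial']
    simpa [constantCoeff_eq] using hs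
  rw [Y.as_sum, map_sum, coeff_sum] at hc
  obtain ⟨u, -, hu⟩ := Finset.exists_ne_zero_of_sum_ne_zero hc
  rw [projectiveMonomialMap, aeval_monomial_monomial, coeff_monomial] at hu
  exact ⟨u, by by_contra hne; simp [hne] at hu⟩

/-! ### Bresinsky's curves -/

theorem bresinskyGenerators_eq {h r : ℕ} (hr : 2 * h = r + 1) :
    bresinskyGenerators h =
      ![r * (r + 1), r * (r + 2), (r + 1) * (r + 2), (r + 1) * (r + 2) + r] := by
  simp only [bresinskyGenerators, hr, Nat.add_sub_cancel, add_assoc, Nat.reduceAdd]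

open MvPolynomial in
theorem proposition4p1 (K : Type*) [Field K] (h : ℕ) (hh : 2 ≤ h) :
    ¬ IsArithmeticallyCohenMacaulay K (bresinskyGenerators h) := by
  obtain ⟨r, hr⟩ : ∃ r, 2 * h = r + 1 := ⟨2 * h - 1, by omega⟩
  obtain ⟨s, rfl⟩ : ∃ s, r = s + 1 := ⟨r - 1, by omega⟩
  have hodd : Odd (s + 1) := ⟨h - 1, by omega⟩
  rw [bresinskyGenerators_eq hr]
  clear hr hh
  generalize ht : s + 1 = r at hodd ⊢
  intro hCM
  set a : Fin 4 → ℕ := ![r * (r + 1), r * (r + 2), (r + 1) * (r + 2), (r + 1) * (r + 2) + r]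
    with ha
  set b : Fin 5 → ℕ := Fin.cons 0 a with hb
  have hb0 : b 0 = 0 := rfl
  have hb1 : b 1 = r * (r + 1) := rfl
  have hb2 : b 2 = r * (r + 2) := rfl
  have hb3 : b 3 = (r + 1) * (r + 2) := rfl
  have hb4 : b 4 = (r + 1) * (r + 2) + r := rfl
  let w := (r + 1) * (r * (r + 1)) + r * ((r + 1) * (r + 2) + r)
  let γ : Fin 2 →₀ ℕ := Finsupp.single 0 (2 * r) + Finsupp.single 1 w
  have hγ : (monomial γ (1 : K)) = X 0 ^ (2 * r) * X 1 ^ w := by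
    rw [X_pow_eq_monomial, X_pow_eq_monomial, monomial_mul, one_mul]
  have hX (i : Fin 5) : projectiveMonomialMap K a (X i) = X 0 * X 1 ^ b i :=
    projectiveMonomialMap_X K a i
  obtain ⟨m, hm⟩ := hCM.exists_weight_eq ⟨0, by rw [ha]; simp; omega⟩ γ
    (X 1 ^ (r + 1) * X 4 ^ r)
    (by
      simp only [map_mul, map_pow, hX, hb1, hb4, hγ, w]
      ring)
    (fun i => by
      change ∃ q, projectiveMonomialMap K a q = X 1 ^ b i * (X 0 * monomial γ 1)
      rw [hγ]
      fin_cases i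
      -- Each witness has degree 2r + 1. The relations used are (r+2) a_1 = (r+1) a_2, (r+1) a_1 +
      -- a_2 = (r-1) a_3 + a_4, (r+1) a_1 + a_3 = r a_2 + a_4 and (r+1)(a_1 + a_4) = (2r+1) a_3. The
      -- second is one shorter on the right, hence the extra `X 0`.
      · refine ⟨X 1 ^ (r + 1) * X 4 ^ r, ?_⟩
        simp [hX, hb0, hb1, hb4, w]
        ring
      · refine ⟨X 2 ^ (r + 1) * X 4 ^ r, ?_⟩
        simp [hX, hb1, hb2, hb4, w]
        ring
      · refine ⟨X 0 * (X 3 ^ s * X 4 ^ (r + 1)), ?_⟩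
        simp [hX, hb0, hb2, hb3, hb4, w, ← ht]
        ring
      · refine ⟨X 2 ^ r * X 4 ^ (r + 1), ?_⟩
        simp [hX, hb2, hb3, hb4, w]
        ring
      · refine ⟨X 3 ^ (2 * r + 1), ?_⟩
        simp [hX, hb3, hb4, w]
        ring)
  rw [weight_projectiveMonomialMap_exponents] at hm
  have h0 := DFunLike.congr_fun hm 0
  have h1 := DFunLike.congr_fun hm 1
  simp [γ, Finsupp.degree_eq_sum, Fin.sum_univ_succ, ha] at h0 h1
  refine bresinsky_no_short_factorization (m₁ := m.tail 0) (m₂ := m.tail 1) (m₃ := m.tail 2)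
    (m₄ := m.tail 3) hodd (by omega) ?_
  rw [← add_assoc, ← add_assoc] at h1
  exact h1
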